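/- Graphs are oriented (with loops and multiple edges allowed), and the underlying graph $U\mathcal C$ of a bicategory $\mathcal C$ has the 0-cells as vertices and the 1-cells as edges; a pseudofunctor $F\colon\mathcal C\to\mathcal D$ has an underlying map of graphs $UF\colon U\mathcal C\to U\mathcal D$. For a map of graphs $H\colon G\to M$, let $$\mathsf B(G)\xrightarrow{\;\Phi_H\;}\mathsf P(H)$$ be the free pseudofunctor on $H$, i.e. the value at $H$ of the left adjoint of the forgetful functor from pseudofunctors and strictly commuting squares of strict functors to maps of graphs. Here $\mathsf B(G)$ is the free bicategory on $G$. The 0-cells of $\mathsf P(H)$ are the vertices of $M$; its 1-cells are the parenthesized formal composites of edges of $M$, formal units, and terms $\Phi_H(w)$ with $w$ a 1-cell of $\mathsf B(G)$, where $\Phi_H(X)$ is identified with $H(X)$ for each edge $X$ of $G$; its 2-cells are generated by associators and unitors, the images under $\Phi_H$ of 2-cells of $\mathsf B(G)$, and the invertible unit and composition constraints of $\Phi_H$, subject only to the axioms of a bicategory and of a pseudofunctor. Let $F\colon\mathcal C\to\mathcal D$ be a pseudofunctor of bicategories. Any strictly commuting square of graph maps from $H\colon G\to M$ to $UF\colon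 U\mathcal C\to U\mathcal D$ induces strict functors of bicategories $\mathsf B(G)\to\mathcal C$ and $\mathsf P(H)\to\mathcal D$ extending the two given graph maps $G\to U\mathcal C$ and $M\to U\mathcal D$ and forming a strictly commuting square with $\Phi_H$ and $F$. A diagram of 2-cells in $\mathcal D$ (a map from a graph to a category $\mathcal D(x,y)$) is an *extended formal diagram* for $F$ if, for some $H$ and some such square, it lifts along $\mathsf P(H)\to\mathcal D$ to a diagram in a hom-category of $\mathsf P(H)$. It is a *formal diagram* for $F$ if it lifts in this way along $\mathsf P(\mathrm{id}_{U\mathcal C})\to\mathcal D$, for the square given by $\mathrm{id}_{U\mathcal C}$ and $UF$; $\Phi_{\mathrm{id}_G}$ is the free pseudofunctor on the graph $G$. **Theorem (coherence for pseudofunctors, relative version).** Every extended formal diagram for a pseudofunctor $F$ commutes: any two directed paths in the diagram with the same start and the same end have the same composite. In particular, every formal diagram for $F$ commutes. -/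

import Mathlib

open CategoryTheory Bicategory

universe w₁ w₂ v₁ v₂ v₃ v₄ v₅ u₁ u₂ u₃ u₄ u₅

/-- The underlying map of graphs of a pseudofunctor: its action on 0-cells and 1-cells. -/
abbrev CategoryTheory.Pseudofunctor.graphMap {C : Type u₃} [Bicategory.{w₁, v₃} C]
    {D : Type u₄} [Bicategory.{w₂, v₄} D] (F : C ⥤ᵖ D) : C ⥤q D :=
  F.toPrelaxFunctor.toPrelaxFunctorStruct.toPrefunctor

namespace FreePseudofunctor

section Target

variable {G : Type u₁} [Quiver.{v₁} G] {M : Type u₂} [Quiver.{v₂} M]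

/-- 1-cells of the target of the free pseudofunctor on a map of graphs `H : G ⥤q M`: formal
composites (with all parenthesizations) of edges of `M`, formal units, and terms `F(w)`, for `w` a
1-cell of the free bicategory on `G`, where for an edge `X` of `G` the term `F(X)` is identified
with the edge `H X` of `M`. As a 1-cell `w` is either an edge, a formal unit or a formal composite,
the terms `F(w)` with `w` not an edge are listed as `mapId a`, which is `F(I_a)`, and
`mapComp f g`, which is `F(f ⊙ g)`; see `mapWord`. -/
inductive Word (H : G ⥤q M) : M → M → Type max u₁ v₁ u₂ v₂
  | edge {A B : M} (Y : A ⟶ B) : Word H A B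
  | mapId (a : FreeBicategory G) : Word H (H.obj a) (H.obj a)
  | mapComp {a b c : FreeBicategory G} (f : a ⟶ b) (g : b ⟶ c) : Word H (H.obj a) (H.obj c)
  | id (A : M) : Word H A A
  | comp {A B C : M} (f : Word H A B) (g : Word H B C) : Word H A C

/-- The 0-cells of the target of the free pseudofunctor on `H : G ⥤q M` are the vertices of `M`. -/
def Target (_H : G ⥤q M) : Type u₂ := M

variable {H : G ⥤q M}

instance : Quiver.{max u₁ v₁ u₂ v₂} (Target H) where
  Hom := fun A B : M => Word H A B

instance : CategoryStruct.{max u₁ v₁ u₂ v₂} (Target H) where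
  id := fun A : M => Word.id A
  comp := @fun _ _ _ => Word.comp

variable (H) in
/-- The 0-cell `H a`. -/
def mapObj (a : FreeBicategory G) : Target H := H.obj a

variable (H) in
/-- The 1-cell `F(w)`, for `w` a 1-cell of the free bicategory on `G`. -/
def mapWord : {a b : FreeBicategory G} → (a ⟶ b) → (mapObj H a ⟶ mapObj H b)
  | _, _, .of X => Word.edge (H.map X)
  | _, _, .id a => Word.mapId a
  | _, _, .comp f g => Word.mapComp f g

/-- Generators of the 2-cells of the target of the free pseudofunctor `F` on `H`: associators and
unitors for the words themselves, the 2-cells `F(η)` where `η` is a 2-cell of the free bicategory on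
`G`, and the invertible structure maps `F(I_a) ≅ I_(H a)` and `F(f ⊙ g) ≅ F(f) ⊙ F(g)`. -/
inductive Hom₂ : {A B : Target H} → (A ⟶ B) → (A ⟶ B) → Type max u₁ v₁ u₂ v₂
  | id {A B} (f : A ⟶ B) : Hom₂ f f
  | vcomp {A B} {f g h : A ⟶ B} (η : Hom₂ f g) (θ : Hom₂ g h) : Hom₂ f h
  | whisker_left {A B C} (f : A ⟶ B) {g h : B ⟶ C} (η : Hom₂ g h) : Hom₂ (f ≫ g) (f ≫ h)
  | whisker_right {A B C} {f g : A ⟶ B} (h : B ⟶ C) (η : Hom₂ f g) : Hom₂ (f ≫ h) (g ≫ h)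
  | associator {A B C D} (f : A ⟶ B) (g : B ⟶ C) (h : C ⟶ D) :
      Hom₂ ((f ≫ g) ≫ h) (f ≫ (g ≫ h))
  | associator_inv {A B C D} (f : A ⟶ B) (g : B ⟶ C) (h : C ⟶ D) :
      Hom₂ (f ≫ (g ≫ h)) ((f ≫ g) ≫ h)
  | right_unitor {A B} (f : A ⟶ B) : Hom₂ (f ≫ (𝟙 B)) f
  | right_unitor_inv {A B} (f : A ⟶ B) : Hom₂ f (f ≫ (𝟙 B))
  | left_unitor {A B} (f : A ⟶ B) : Hom₂ ((𝟙 A) ≫ f) f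
  | left_unitor_inv {A B} (f : A ⟶ B) : Hom₂ f ((𝟙 A) ≫ f)
  | map₂ {a b : FreeBicategory G} {f g : a ⟶ b} (η : f ⟶ g) : Hom₂ (mapWord H f) (mapWord H g)
  | map_id (a : FreeBicategory G) : Hom₂ (mapWord H (𝟙 a)) (𝟙 (mapObj H a))
  | map_id_inv (a : FreeBicategory G) : Hom₂ (𝟙 (mapObj H a)) (mapWord H (𝟙 a))
  | map_comp {a b c : FreeBicategory G} (f : a ⟶ b) (g : b ⟶ c) :
      Hom₂ (mapWord H (f ≫ g)) (mapWord H f ≫ mapWord H g)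
  | map_comp_inv {a b c : FreeBicategory G} (f : a ⟶ b) (g : b ⟶ c) :
      Hom₂ (mapWord H f ≫ mapWord H g) (mapWord H (f ≫ g))

section

local infixr:0 " ≫' " => Hom₂.vcomp
local notation "𝟙'" => Hom₂.id
local notation f " ◁' " η => Hom₂.whisker_left f η
local notation η " ▷' " h => Hom₂.whisker_right h η

/-- The relations between 2-cells of the target of the free pseudofunctor `F` on `H`: the axioms of
a bicategory, and the axioms saying that `F` is a pseudofunctor. -/
inductive Rel : {A B : Target H} → {f g : A ⟶ B} → Hom₂ f g → Hom₂ f g → Prop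
  | vcomp_right {A B} {f g h : A ⟶ B} (η : Hom₂ f g) (θ₁ θ₂ : Hom₂ g h) :
      Rel θ₁ θ₂ → Rel (η ≫' θ₁) (η ≫' θ₂)
  | vcomp_left {A B} {f g h : A ⟶ B} (η₁ η₂ : Hom₂ f g) (θ : Hom₂ g h) :
      Rel η₁ η₂ → Rel (η₁ ≫' θ) (η₂ ≫' θ)
  | id_comp {A B} {f g : A ⟶ B} (η : Hom₂ f g) : Rel (𝟙' f ≫' η) η
  | comp_id {A B} {f g : A ⟶ B} (η : Hom₂ f g) : Rel (η ≫' 𝟙' g) η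
  | assoc {A B} {f g h i : A ⟶ B} (η : Hom₂ f g) (θ : Hom₂ g h) (ι : Hom₂ h i) :
      Rel ((η ≫' θ) ≫' ι) (η ≫' θ ≫' ι)
  | whisker_left {A B C} (f : A ⟶ B) (g h : B ⟶ C) (η η' : Hom₂ g h) :
      Rel η η' → Rel (f ◁' η) (f ◁' η')
  | whisker_left_id {A B C} (f : A ⟶ B) (g : B ⟶ C) : Rel (f ◁' 𝟙' g) (𝟙' (f ≫ g))
  | whisker_left_comp {A B C} (f : A ⟶ B) {g h i : B ⟶ C} (η : Hom₂ g h) (θ : Hom₂ h i) :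
      Rel (f ◁' (η ≫' θ)) ((f ◁' η) ≫' (f ◁' θ))
  | id_whisker_left {A B} {f g : A ⟶ B} (η : Hom₂ f g) :
      Rel (𝟙 A ◁' η) (.left_unitor f ≫' η ≫' .left_unitor_inv g)
  | comp_whisker_left {A B C D} (f : A ⟶ B) (g : B ⟶ C) {h h' : C ⟶ D} (η : Hom₂ h h') :
      Rel ((f ≫ g) ◁' η)
        (.associator f g h ≫' (f ◁' (g ◁' η)) ≫' .associator_inv f g h')
  | whisker_right {A B C} (f g : A ⟶ B) (h : B ⟶ C) (η η' : Hom₂ f g) :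
      Rel η η' → Rel (η ▷' h) (η' ▷' h)
  | id_whisker_right {A B C} (f : A ⟶ B) (g : B ⟶ C) : Rel (𝟙' f ▷' g) (𝟙' (f ≫ g))
  | comp_whisker_right {A B C} {f g h : A ⟶ B} (i : B ⟶ C) (η : Hom₂ f g) (θ : Hom₂ g h) :
      Rel ((η ≫' θ) ▷' i) ((η ▷' i) ≫' (θ ▷' i))
  | whisker_right_id {A B} {f g : A ⟶ B} (η : Hom₂ f g) :
      Rel (η ▷' 𝟙 B) (.right_unitor f ≫' η ≫' .right_unitor_inv g)
  | whisker_right_comp {A B C D} {f f' : A ⟶ B} (g : B ⟶ C) (h : C ⟶ D) (η : Hom₂ f f') :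
      Rel (η ▷' (g ≫ h))
        (.associator_inv f g h ≫' ((η ▷' g) ▷' h) ≫' .associator f' g h)
  | whisker_assoc {A B C D} (f : A ⟶ B) {g g' : B ⟶ C} (η : Hom₂ g g') (h : C ⟶ D) :
      Rel ((f ◁' η) ▷' h)
        (.associator f g h ≫' (f ◁' (η ▷' h)) ≫' .associator_inv f g' h)
  | whisker_exchange {A B C} {f g : A ⟶ B} {h i : B ⟶ C} (η : Hom₂ f g) (θ : Hom₂ h i) :
      Rel ((f ◁' θ) ≫' (η ▷' i)) ((η ▷' h) ≫' (g ◁' θ))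
  | associator_hom_inv {A B C D} (f : A ⟶ B) (g : B ⟶ C) (h : C ⟶ D) :
      Rel (.associator f g h ≫' .associator_inv f g h) (𝟙' ((f ≫ g) ≫ h))
  | associator_inv_hom {A B C D} (f : A ⟶ B) (g : B ⟶ C) (h : C ⟶ D) :
      Rel (.associator_inv f g h ≫' .associator f g h) (𝟙' (f ≫ g ≫ h))
  | left_unitor_hom_inv {A B} (f : A ⟶ B) :
      Rel (.left_unitor f ≫' .left_unitor_inv f) (𝟙' (𝟙 A ≫ f))
  | left_unitor_inv_hom {A B} (f : A ⟶ B) :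
      Rel (.left_unitor_inv f ≫' .left_unitor f) (𝟙' f)
  | right_unitor_hom_inv {A B} (f : A ⟶ B) :
      Rel (.right_unitor f ≫' .right_unitor_inv f) (𝟙' (f ≫ 𝟙 B))
  | right_unitor_inv_hom {A B} (f : A ⟶ B) :
      Rel (.right_unitor_inv f ≫' .right_unitor f) (𝟙' f)
  | pentagon {A B C D E} (f : A ⟶ B) (g : B ⟶ C) (h : C ⟶ D) (i : D ⟶ E) :
      Rel ((.associator f g h ▷' i) ≫' .associator f (g ≫ h) i ≫' (f ◁' .associator g h i))
        (.associator (f ≫ g) h i ≫' .associator f g (h ≫ i))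
  | triangle {A B C} (f : A ⟶ B) (g : B ⟶ C) :
      Rel (.associator f (𝟙 B) g ≫' (f ◁' .left_unitor g)) (.right_unitor f ▷' g)
  | map₂_id {a b : FreeBicategory G} (f : a ⟶ b) : Rel (.map₂ (𝟙 f)) (𝟙' (mapWord H f))
  | map₂_comp {a b : FreeBicategory G} {f g h : a ⟶ b} (η : f ⟶ g) (θ : g ⟶ h) :
      Rel (.map₂ (η ≫ θ)) (.map₂ η ≫' .map₂ θ)
  | map_id_hom_inv (a : FreeBicategory G) :
      Rel (.map_id a ≫' .map_id_inv a) (𝟙' (mapWord H (𝟙 a)))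
  | map_id_inv_hom (a : FreeBicategory G) :
      Rel (.map_id_inv a ≫' .map_id a) (𝟙' (𝟙 (mapObj H a)))
  | map_comp_hom_inv {a b c : FreeBicategory G} (f : a ⟶ b) (g : b ⟶ c) :
      Rel (.map_comp f g ≫' .map_comp_inv f g) (𝟙' (mapWord H (f ≫ g)))
  | map_comp_inv_hom {a b c : FreeBicategory G} (f : a ⟶ b) (g : b ⟶ c) :
      Rel (.map_comp_inv f g ≫' .map_comp f g) (𝟙' (mapWord H f ≫ mapWord H g))
  | map₂_whisker_left {a b c : FreeBicategory G} (f : a ⟶ b) {g h : b ⟶ c} (η : g ⟶ h) :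
      Rel (.map₂ (f ◁ η))
        (.map_comp f g ≫' (mapWord H f ◁' .map₂ η) ≫' .map_comp_inv f h)
  | map₂_whisker_right {a b c : FreeBicategory G} {f g : a ⟶ b} (η : f ⟶ g) (h : b ⟶ c) :
      Rel (.map₂ (η ▷ h))
        (.map_comp f h ≫' (.map₂ η ▷' mapWord H h) ≫' .map_comp_inv g h)
  | map₂_associator {a b c d : FreeBicategory G} (f : a ⟶ b) (g : b ⟶ c) (h : c ⟶ d) :
      Rel (.map₂ (α_ f g h).hom)
        (.map_comp (f ≫ g) h ≫' (.map_comp f g ▷' mapWord H h) ≫'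
          .associator (mapWord H f) (mapWord H g) (mapWord H h) ≫'
          (mapWord H f ◁' .map_comp_inv g h) ≫' .map_comp_inv f (g ≫ h))
  | map₂_left_unitor {a b : FreeBicategory G} (f : a ⟶ b) :
      Rel (.map₂ (λ_ f).hom)
        (.map_comp (𝟙 a) f ≫' (.map_id a ▷' mapWord H f) ≫' .left_unitor (mapWord H f))
  | map₂_right_unitor {a b : FreeBicategory G} (f : a ⟶ b) :
      Rel (.map₂ (ρ_ f).hom)
        (.map_comp f (𝟙 b) ≫' (mapWord H f ◁' .map_id b) ≫' .right_unitor (mapWord H f))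

end

instance homCategory (A B : Target H) : Category (A ⟶ B) where
  Hom f g := Quot (@Rel _ _ _ _ _ A B f g)
  id f := Quot.mk Rel (Hom₂.id f)
  comp := @fun _ _ _ => Quot.map₂ Hom₂.vcomp Rel.vcomp_right Rel.vcomp_left
  id_comp := by
    rintro f g ⟨η⟩
    exact Quot.sound (Rel.id_comp η)
  comp_id := by
    rintro f g ⟨η⟩
    exact Quot.sound (Rel.comp_id η)
  assoc := by
    rintro f g h i ⟨η⟩ ⟨θ⟩ ⟨ι⟩
    exact Quot.sound (Rel.assoc η θ ι)

/-- The target of the free pseudofunctor on `H`, as a bicategory. -/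
instance bicategory : Bicategory (Target H) where
  homCategory := homCategory
  whiskerLeft := @fun _ _ _ f g h η => Quot.map (Hom₂.whisker_left f) (Rel.whisker_left f g h) η
  whiskerLeft_id := @fun _ _ _ f g => Quot.sound (Rel.whisker_left_id f g)
  associator := @fun _ _ _ _ f g h =>
    { hom := Quot.mk Rel (Hom₂.associator f g h)
      inv := Quot.mk Rel (Hom₂.associator_inv f g h)
      hom_inv_id := Quot.sound (Rel.associator_hom_inv f g h)
      inv_hom_id := Quot.sound (Rel.associator_inv_hom f g h) }
  leftUnitor := @fun _ _ f =>
    { hom := Quot.mk Rel (Hom₂.left_unitor f)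
      inv := Quot.mk Rel (Hom₂.left_unitor_inv f)
      hom_inv_id := Quot.sound (Rel.left_unitor_hom_inv f)
      inv_hom_id := Quot.sound (Rel.left_unitor_inv_hom f) }
  rightUnitor := @fun _ _ f =>
    { hom := Quot.mk Rel (Hom₂.right_unitor f)
      inv := Quot.mk Rel (Hom₂.right_unitor_inv f)
      hom_inv_id := Quot.sound (Rel.right_unitor_hom_inv f)
      inv_hom_id := Quot.sound (Rel.right_unitor_inv_hom f) }
  whiskerLeft_comp := by
    rintro a b c f g h i ⟨η⟩ ⟨θ⟩
    exact Quot.sound (Rel.whisker_left_comp f η θ)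
  id_whiskerLeft := by
    rintro a b f g ⟨η⟩
    exact Quot.sound (Rel.id_whisker_left η)
  comp_whiskerLeft := by
    rintro a b c d f g h h' ⟨η⟩
    exact Quot.sound (Rel.comp_whisker_left f g η)
  whiskerRight := @fun _ _ _ f g η h => Quot.map (Hom₂.whisker_right h) (Rel.whisker_right f g h) η
  id_whiskerRight := @fun _ _ _ f g => Quot.sound (Rel.id_whisker_right f g)
  comp_whiskerRight := by
    rintro a b c f g h ⟨η⟩ ⟨θ⟩ i
    exact Quot.sound (Rel.comp_whisker_right i η θ)
  whiskerRight_id := by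
    rintro a b f g ⟨η⟩
    exact Quot.sound (Rel.whisker_right_id η)
  whiskerRight_comp := by
    rintro a b c d f f' ⟨η⟩ g h
    exact Quot.sound (Rel.whisker_right_comp g h η)
  whisker_assoc := by
    rintro a b c d f g g' ⟨η⟩ h
    exact Quot.sound (Rel.whisker_assoc f η h)
  whisker_exchange := by
    rintro a b c f g h i ⟨η⟩ ⟨θ⟩
    exact Quot.sound (Rel.whisker_exchange η θ)
  pentagon := @fun _ _ _ _ _ f g h i => Quot.sound (Rel.pentagon f g h i)
  triangle := @fun _ _ _ f g => Quot.sound (Rel.triangle f g)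

variable (H) in
/-- The free pseudofunctor on a map of graphs `H : G ⥤q M`. Its source is the free bicategory
on `G`. -/
def free : FreeBicategory G ⥤ᵖ Target H where
  obj := mapObj H
  map := mapWord H
  map₂ η := Quot.mk Rel (Hom₂.map₂ η)
  map₂_id f := Quot.sound (Rel.map₂_id f)
  map₂_comp η θ := Quot.sound (Rel.map₂_comp η θ)
  mapId a :=
    { hom := Quot.mk Rel (Hom₂.map_id a)
      inv := Quot.mk Rel (Hom₂.map_id_inv a)
      hom_inv_id := Quot.sound (Rel.map_id_hom_inv a)
      inv_hom_id := Quot.sound (Rel.map_id_inv_hom a) }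
  mapComp f g :=
    { hom := Quot.mk Rel (Hom₂.map_comp f g)
      inv := Quot.mk Rel (Hom₂.map_comp_inv f g)
      hom_inv_id := Quot.sound (Rel.map_comp_hom_inv f g)
      inv_hom_id := Quot.sound (Rel.map_comp_inv_hom f g) }
  map₂_whisker_left f _ _ η := Quot.sound (Rel.map₂_whisker_left f η)
  map₂_whisker_right η h := Quot.sound (Rel.map₂_whisker_right η h)
  map₂_associator f g h := Quot.sound (Rel.map₂_associator f g h)
  map₂_left_unitor f := Quot.sound (Rel.map₂_left_unitor f)
  map₂_right_unitor f := Quot.sound (Rel.map₂_right_unitor f)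

variable (H) in
/-- The inclusion of the graph `M` in the target of the free pseudofunctor on `H : G ⥤q M`. -/
def ofTarget : M ⥤q Target H where
  obj A := A
  map Y := Word.edge Y

/-- The unit square of the free pseudofunctor commutes strictly: `F(X)` is the edge `H X`. -/
theorem of_comp_free : FreeBicategory.of ⋙q (free H).graphMap = H ⋙q ofTarget H := rfl

end Target

section Comparison

variable {G : Type u₁} [Quiver.{v₁} G] {M : Type u₂} [Quiver.{v₂} M]
  {C : Type u₃} [Bicategory.{w₁, v₃} C] {D : Type u₄} [Bicategory.{w₂, v₄} D]

theorem prefunctor_ext {V : Type u₁} [Quiver.{v₁} V] {W : Type u₂} [Quiver.{v₂} W] {P Q : V ⥤q W}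
    (hobj : ∀ a, P.obj a = Q.obj a) (hmap : ∀ (a b : V) (f : a ⟶ b), P.map f ≍ Q.map f) :
    P = Q := by
  obtain ⟨Pobj, Pmap⟩ := P
  obtain ⟨Qobj, Qmap⟩ := Q
  obtain rfl : Pobj = Qobj := funext hobj
  congr
  funext a b f
  exact eq_of_heq (hmap a b f)

theorem prefunctor_map_heq {V : Type u₁} [Quiver.{v₁} V] {W : Type u₂} [Quiver.{v₂} W]
    {P Q : V ⥤q W} (h : P = Q) {a b : V} (f : a ⟶ b) : P.map f ≍ Q.map f := by
  subst h; rfl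

theorem pseudofunctor_ext {P Q : C ⥤ᵖ D} (h : P.toPrelaxFunctor = Q.toPrelaxFunctor)
    (hid : ∀ a, P.mapId a ≍ Q.mapId a)
    (hcomp : ∀ {a b c : C} (f : a ⟶ b) (g : b ⟶ c), P.mapComp f g ≍ Q.mapComp f g) : P = Q := by
  obtain ⟨P', Pid, Pcomp⟩ := P
  obtain ⟨Q', Qid, Qcomp⟩ := Q
  obtain rfl : P' = Q' := h
  congr
  · funext a
    exact eq_of_heq (hid a)
  · funext a b c f g
    exact eq_of_heq (hcomp f g)

/-- A strictly commuting square of graph maps from `H : G ⥤q M` to the map of graphs underlying a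
pseudofunctor `F`. -/
structure GraphSquare (H : G ⥤q M) (F : C ⥤ᵖ D) where
  left : G ⥤q C
  right : M ⥤q D
  comm : left ⋙q F.graphMap = H ⋙q right

/-- Replace the underlying map of graphs of a pseudofunctor by an equal one. -/
def replaceGraphMap (P : C ⥤ᵖ D) (S : C ⥤q D) (h : P.graphMap = S) : C ⥤ᵖ D where
  toPrefunctor := S
  map₂ {a b f g} η := Eq.rec (motive := fun S _ => S.map f ⟶ S.map g) (P.map₂ η) h
  map₂_id f := by subst h; exact P.map₂_id f
  map₂_comp η θ := by subst h; exact P.map₂_comp η θ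
  mapId a := Eq.rec (motive := fun S _ => S.map (𝟙 a) ≅ 𝟙 (S.obj a)) (P.mapId a) h
  mapComp f g := Eq.rec (motive := fun S _ => S.map (f ≫ g) ≅ S.map f ≫ S.map g) (P.mapComp f g) h
  map₂_whisker_left f _ _ η := by subst h; exact P.map₂_whisker_left f η
  map₂_whisker_right η k := by subst h; exact P.map₂_whisker_right η k
  map₂_associator f g k := by subst h; exact P.map₂_associator f g k
  map₂_left_unitor f := by subst h; exact P.map₂_left_unitor f
  map₂_right_unitor f := by subst h; exact P.map₂_right_unitor f

theorem replaceGraphMap_eq (P : C ⥤ᵖ D) (S : C ⥤q D) (h : P.graphMap = S) :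
    replaceGraphMap P S h = P := by
  subst h; rfl

namespace GraphSquare

variable {H : G ⥤q M} {F : C ⥤ᵖ D} (S : GraphSquare H F)

/-- The composite of the strict extension of `S.left` to the free bicategory on `G` with `F`. -/
def base : FreeBicategory G ⥤ᵖ D := (FreeBicategory.lift S.left).comp F

theorem obj_eq (a : FreeBicategory G) : S.base.obj a = S.right.obj (H.obj a) :=
  congrArg (fun P : G ⥤q D => P.obj a) S.comm

/-- The comparison functor on 1-cells. -/
def compWord : {A B : Target H} → (A ⟶ B) → (S.right.obj A ⟶ S.right.obj B)
  | _, _, .edge Y => S.right.map Y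
  | _, _, .mapId a => Quiver.homOfEq (S.base.map (𝟙 a)) (S.obj_eq a) (S.obj_eq a)
  | _, _, .mapComp (a := a) (c := c) f g =>
      Quiver.homOfEq (S.base.map (f ≫ g)) (S.obj_eq a) (S.obj_eq c)
  | _, _, .id A => 𝟙 (S.right.obj A)
  | _, _, .comp f g => compWord f ≫ compWord g

/-- The comparison functor on the underlying graphs. -/
def compGraphMap : Target H ⥤q D where
  obj A := S.right.obj A
  map f := S.compWord f

theorem base_graphMap : S.base.graphMap = (free H).graphMap ⋙q S.compGraphMap := by
  refine prefunctor_ext S.obj_eq fun a b f => ?_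
  change FreeBicategory.Hom (B := G) a b at f
  revert f
  change G at a b
  rintro (X | _ | ⟨f, g⟩)
  · exact prefunctor_map_heq S.comm X
  · exact (Quiver.homOfEq_heq _ _ _).symm
  · exact (Quiver.homOfEq_heq _ _ _).symm

/-- `S.base`, with its values on 0-cells and 1-cells rewritten as values of the comparison. -/
def base' : FreeBicategory G ⥤ᵖ D :=
  replaceGraphMap S.base ((free H).graphMap ⋙q S.compGraphMap) S.base_graphMap

/-- The comparison functor on generating 2-cells. -/
def comp₂ : {A B : Target H} → {f g : A ⟶ B} → Hom₂ f g → (S.compWord f ⟶ S.compWord g)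
  | _, _, _, _, .id _ => 𝟙 _
  | _, _, _, _, .vcomp η θ => comp₂ η ≫ comp₂ θ
  | _, _, _, _, .whisker_left f η => S.compWord f ◁ comp₂ η
  | _, _, _, _, .whisker_right h η => comp₂ η ▷ S.compWord h
  | _, _, _, _, .associator _ _ _ => (α_ _ _ _).hom
  | _, _, _, _, .associator_inv _ _ _ => (α_ _ _ _).inv
  | _, _, _, _, .right_unitor _ => (ρ_ _).hom
  | _, _, _, _, .right_unitor_inv _ => (ρ_ _).inv
  | _, _, _, _, .left_unitor _ => (λ_ _).hom
  | _, _, _, _, .left_unitor_inv _ => (λ_ _).inv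
  | _, _, _, _, .map₂ η => S.base'.map₂ η
  | _, _, _, _, .map_id a => (S.base'.mapId a).hom
  | _, _, _, _, .map_id_inv a => (S.base'.mapId a).inv
  | _, _, _, _, .map_comp f g => (S.base'.mapComp f g).hom
  | _, _, _, _, .map_comp_inv f g => (S.base'.mapComp f g).inv

theorem comp₂_congr {A B : Target H} {f g : A ⟶ B} {η θ : Hom₂ f g} (h : Rel η θ) :
    S.comp₂ η = S.comp₂ θ := by
  induction h with
  | vcomp_right _ _ _ _ ih => exact congrArg (_ ≫ ·) ih
  | vcomp_left _ _ _ _ ih => exact congrArg (· ≫ _) ih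
  | id_comp => exact Category.id_comp _
  | comp_id => exact Category.comp_id _
  | assoc => exact Category.assoc _ _ _
  | whisker_left f _ _ _ _ _ ih => exact congrArg (S.compWord f ◁ ·) ih
  | whisker_left_id => exact Bicategory.whiskerLeft_id _ _
  | whisker_left_comp => exact Bicategory.whiskerLeft_comp _ _ _
  | id_whisker_left => exact Bicategory.id_whiskerLeft _
  | comp_whisker_left => exact Bicategory.comp_whiskerLeft _ _ _
  | whisker_right _ _ h _ _ _ ih => exact congrArg (· ▷ S.compWord h) ih
  | id_whisker_right => exact Bicategory.id_whiskerRight _ _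
  | comp_whisker_right => exact Bicategory.comp_whiskerRight _ _ _
  | whisker_right_id => exact Bicategory.whiskerRight_id _
  | whisker_right_comp => exact Bicategory.whiskerRight_comp _ _ _
  | whisker_assoc => exact Bicategory.whisker_assoc _ _ _
  | whisker_exchange => exact Bicategory.whisker_exchange _ _
  | associator_hom_inv => exact Iso.hom_inv_id _
  | associator_inv_hom => exact Iso.inv_hom_id _
  | left_unitor_hom_inv => exact Iso.hom_inv_id _
  | left_unitor_inv_hom => exact Iso.inv_hom_id _
  | right_unitor_hom_inv => exact Iso.hom_inv_id _
  | right_unitor_inv_hom => exact Iso.inv_hom_id _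
  | pentagon => exact Bicategory.pentagon _ _ _ _
  | triangle => exact Bicategory.triangle _ _
  | map₂_id f => exact S.base'.map₂_id f
  | map₂_comp η θ => exact S.base'.map₂_comp η θ
  | map_id_hom_inv a => exact (S.base'.mapId a).hom_inv_id
  | map_id_inv_hom a => exact (S.base'.mapId a).inv_hom_id
  | map_comp_hom_inv f g => exact (S.base'.mapComp f g).hom_inv_id
  | map_comp_inv_hom f g => exact (S.base'.mapComp f g).inv_hom_id
  | map₂_whisker_left f η => exact S.base'.map₂_whisker_left f η
  | map₂_whisker_right η h => exact S.base'.map₂_whisker_right η h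
  | map₂_associator f g h => exact S.base'.map₂_associator f g h
  | map₂_left_unitor f => exact S.base'.map₂_left_unitor f
  | map₂_right_unitor f => exact S.base'.map₂_right_unitor f

/-- The comparison functor `Target H → D` induced by a square `S` from `H : G ⥤q M` to the map of
graphs underlying `F : C ⥤ᵖ D`: the strict functor of bicategories which extends the graph map
`S.right : M ⥤q D` and carries the free pseudofunctor on `H` to the composite of `F` with the
strict extension `FreeBicategory G → C` of `S.left`. -/
def comparison : StrictPseudofunctor (Target H) D where
  obj A := S.right.obj A
  map f := S.compWord f
  map₂ := Quot.lift S.comp₂ fun _ _ h => S.comp₂_congr h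
  map₂_id _ := rfl
  map₂_comp := by rintro _ _ _ _ _ ⟨η⟩ ⟨θ⟩; rfl
  mapId _ := Iso.refl _
  mapComp _ _ := Iso.refl _
  map₂_whisker_left := by
    rintro _ _ _ f _ _ ⟨η⟩
    exact ((Category.id_comp _).trans (Category.comp_id _)).symm
  map₂_whisker_right := by
    rintro _ _ _ _ _ ⟨η⟩ h
    exact ((Category.id_comp _).trans (Category.comp_id _)).symm
  map₂_associator f g h := by
    change (α_ (S.compWord f) (S.compWord g) (S.compWord h)).hom =
      𝟙 _ ≫ 𝟙 (S.compWord f ≫ S.compWord g) ▷ S.compWord h ≫ (α_ _ _ _).hom ≫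
        S.compWord f ◁ 𝟙 (S.compWord g ≫ S.compWord h) ≫ 𝟙 _
    simp only [id_whiskerRight, whiskerLeft_id, Category.id_comp, Category.comp_id]
  map₂_left_unitor {a _} f := by
    change (λ_ (S.compWord f)).hom = 𝟙 _ ≫ 𝟙 (𝟙 (S.right.obj a)) ▷ S.compWord f ≫ (λ_ _).hom
    simp only [id_whiskerRight, Category.id_comp]
  map₂_right_unitor {_ b} f := by
    change (ρ_ (S.compWord f)).hom = 𝟙 _ ≫ S.compWord f ◁ 𝟙 (𝟙 (S.right.obj b)) ≫ (ρ_ _).hom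
    simp only [whiskerLeft_id, Category.id_comp]
  map_id _ := rfl
  mapId_eq_eqToIso _ := rfl
  map_comp _ _ := rfl
  mapComp_eq_eqToIso _ _ := rfl

/-- The comparison functor extends the given graph map `M ⥤q D`. -/
theorem ofTarget_comp_comparison :
    ofTarget H ⋙q S.comparison.toPseudofunctor.graphMap = S.right := rfl

/-- The square of pseudofunctors formed by the comparison functor commutes strictly. -/
theorem free_comp_comparison :
    (free H).comp S.comparison.toPseudofunctor = (FreeBicategory.lift S.left).comp F := by
  refine Eq.trans ?_ (replaceGraphMap_eq S.base _ S.base_graphMap)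
  refine pseudofunctor_ext rfl (fun a => heq_of_eq ?_) (fun f g => heq_of_eq ?_)
  · exact Iso.ext (Category.comp_id _)
  · exact Iso.ext (Category.comp_id _)



end GraphSquare

end Comparison

section Diagrams

variable {C : Type u₃} [Bicategory.{w₁, v₃} C] {D : Type u₄} [Bicategory.{w₂, v₄} D]

/-- A diagram of shape `J` (a graph) in a category commutes if any two paths in `J` with the same
endpoints have the same composite. -/
def DiagramCommutes {J : Type u₅} [Quiver.{v₅} J] {K : Type u₁} [Category.{v₁} K]
    (P : J ⥤q K) : Prop :=
  ∀ (i j : J) (p q : Quiver.Path i j), composePath (P.mapPath p) = composePath (P.mapPath q)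

/-- A diagram of 2-cells in `D` is an extended formal diagram for `F : C ⥤ᵖ D`, with respect to a
square from a map of graphs `H` to the map of graphs underlying `F`, if it lifts along the
comparison functor from the target of the free pseudofunctor on `H` to `D`. -/
inductive IsExtendedFormalDiagram {G : Type u₁} [Quiver.{v₁} G] {M : Type u₂} [Quiver.{v₂} M]
    {H : G ⥤q M} {F : C ⥤ᵖ D} (S : GraphSquare H F) {J : Type u₅} [Quiver.{v₅} J] :
    {x y : D} → (J ⥤q (x ⟶ y)) → Prop
  | of_lift {A B : Target H} (L : J ⥤q (A ⟶ B)) :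
      IsExtendedFormalDiagram S
        (L ⋙q (S.comparison.toPrelaxFunctor.mapFunctor A B).toPrefunctor)

/-- The square whose left side is the identity of the graph underlying `C`, from the identity map
of that graph to the map of graphs underlying `F : C ⥤ᵖ D`. -/
def idSquare (F : C ⥤ᵖ D) : GraphSquare (Prefunctor.id C) F where
  left := Prefunctor.id C
  right := F.graphMap
  comm := rfl

/-- A diagram of 2-cells in `D` is a formal diagram for `F : C ⥤ᵖ D` if it lifts along the
comparison functor from the target of the free pseudofunctor on the graph underlying `C`. The free
pseudofunctor on a graph `G` (left adjoint to taking the graph underlying the source) is the free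
pseudofunctor on the identity map of `G`, because maps of graphs from `G` to the source of a map of
graphs `E` are the same as commuting squares from the identity of `G` to `E`. -/
def IsFormalDiagram (F : C ⥤ᵖ D) {J : Type u₅} [Quiver.{v₅} J] {x y : D}
    (P : J ⥤q (x ⟶ y)) : Prop :=
  IsExtendedFormalDiagram (idSquare F) P

end Diagrams

end FreePseudofunctor

/-! A lifted diagram commutes as soon as the hom-category it lifts to is thin, so the point is that
any two parallel 2-cells of `Target H` are equal. This is reduced to the coherence theorem for
bicategories, which says that `FreeBicategory M` is locally thin.

The strict functor `inclusion H` is the identity on 0-cells. Every 1-cell `w` of `Target H` is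
isomorphic, through constraints of the free pseudofunctor, to a 1-cell in its image: each term
`F(u)` is expanded until only edges remain, and `F(X)` is already the edge `H X`. Fix these
isomorphisms (`mapWordIso`, `expandIso`). The key claim, `conjInImage_expandIso`, is that
conjugation by them carries every 2-cell of `Target H` to one in the image of `inclusion H`. Two
parallel 2-cells then have parallel preimages in a thin category, hence coincide.

The property `ConjInImage` is stable under composition and whiskering, so only generators matter.
Constraints become identities by the choice of the isomorphisms; associators and unitors become
those of `FreeBicategory M`. For `F(η)`, an induction on `η` applies: the pseudofunctor axioms
rewrite the image of each generator by constraints, structural 2-cells and whiskerings. -/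

namespace FreePseudofunctor

/-! ### 2-cells conjugate into the image of a pseudofunctor -/

section Image

variable {B : Type u₁} [Bicategory.{w₁, v₁} B] {C : Type u₂} [Bicategory.{w₂, v₂} C] (J : B ⥤ᵖ C)

-- The axioms of a pseudofunctor treat the structural 2-cells in one direction only; the inverses
-- are generators of a free bicategory too and need their own formulas.
variable {J} in
theorem map₂_associator_inv {a b c d : B} (f : a ⟶ b) (g : b ⟶ c) (h : c ⟶ d) :
    J.map₂ (α_ f g h).inv = (J.mapComp f (g ≫ h)).hom ≫ J.map f ◁ (J.mapComp g h).hom ≫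
      (α_ (J.map f) (J.map g) (J.map h)).inv ≫ (J.mapComp f g).inv ▷ J.map h ≫
        (J.mapComp (f ≫ g) h).inv := by
  simp [J.mapComp_assoc_left_inv]

variable {J} in
theorem map₂_leftUnitor_inv {a b : B} (f : a ⟶ b) :
    J.map₂ (λ_ f).inv =
      (λ_ (J.map f)).inv ≫ (J.mapId a).inv ▷ J.map f ≫ (J.mapComp (𝟙 a) f).inv := by
  simp [J.whiskerRight_mapId_inv]

variable {J} in
theorem map₂_rightUnitor_inv {a b : B} (f : a ⟶ b) :
    J.map₂ (ρ_ f).inv =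
      (ρ_ (J.map f)).inv ≫ J.map f ◁ (J.mapId b).inv ≫ (J.mapComp f (𝟙 b)).inv := by
  simp [J.whiskerLeft_mapId_inv]

/-- Conjugating the 2-cell `η` by the isomorphisms `e` and `d` yields a 2-cell in the image of the
pseudofunctor `J`. -/
def ConjInImage {a b : B} {f g : J.obj a ⟶ J.obj b} {f' g' : a ⟶ b} (e : f ≅ J.map f')
    (d : g ≅ J.map g') (η : f ⟶ g) : Prop :=
  ∃ η' : f' ⟶ g', η ≫ d.hom = e.hom ≫ J.map₂ η'

/-- The horizontal composite of two isomorphisms with 1-cells in the image of `J`. -/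
def compImageIso {a b c : B} {f : J.obj a ⟶ J.obj b} {g : J.obj b ⟶ J.obj c} {f' : a ⟶ b}
    {g' : b ⟶ c} (e : f ≅ J.map f') (d : g ≅ J.map g') : f ≫ g ≅ J.map (f' ≫ g') :=
  whiskerRightIso e g ≪≫ whiskerLeftIso (J.map f') d ≪≫ (J.mapComp f' g').symm

namespace ConjInImage

variable {J} {a b c d : B}

/-- The preimage is an identity. This covers constraints, since the chosen isomorphism at their
source starts with the constraint itself. -/
theorem of_eq {f g : J.obj a ⟶ J.obj b} {g' : a ⟶ b} {e : f ≅ J.map g'} {d : g ≅ J.map g'}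
    {η : f ⟶ g} (h : η ≫ d.hom = e.hom) : ConjInImage J e d η :=
  ⟨𝟙 g', by simp [h]⟩

theorem id {f : J.obj a ⟶ J.obj b} {f' : a ⟶ b} (e : f ≅ J.map f') : ConjInImage J e e (𝟙 f) :=
  of_eq (Category.id_comp _)

theorem comp {f g h : J.obj a ⟶ J.obj b} {f' g' h' : a ⟶ b} {e₁ : f ≅ J.map f'}
    {e₂ : g ≅ J.map g'} {e₃ : h ≅ J.map h'} {η : f ⟶ g} {θ : g ⟶ h} :
    ConjInImage J e₁ e₂ η → ConjInImage J e₂ e₃ θ → ConjInImage J e₁ e₃ (η ≫ θ) := by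
  rintro ⟨η', hη⟩ ⟨θ', hθ⟩
  exact ⟨η' ≫ θ', by rw [Category.assoc, hθ, reassoc_of% hη, J.map₂_comp]⟩

/-- Interchange moves `e` past `η`, and `J.mapComp` is natural in its second argument. -/
theorem whiskerLeft {f : J.obj a ⟶ J.obj b} {f' : a ⟶ b} (e : f ≅ J.map f')
    {g h : J.obj b ⟶ J.obj c} {g' h' : b ⟶ c} {e₁ : g ≅ J.map g'} {e₂ : h ≅ J.map h'} {η : g ⟶ h} :
    ConjInImage J e₁ e₂ η →
      ConjInImage J (compImageIso J e e₁) (compImageIso J e e₂) (f ◁ η) := by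
  rintro ⟨η', hη⟩
  refine ⟨f' ◁ η', ?_⟩
  simp only [compImageIso, Iso.trans_hom, whiskerRightIso_hom, whiskerLeftIso_hom, Iso.symm_hom,
    J.map₂_whisker_left, Category.assoc, Iso.inv_hom_id_assoc]
  rw [whisker_exchange_assoc, ← whiskerLeft_comp_assoc, hη, whiskerLeft_comp_assoc]

theorem whiskerRight {g h : J.obj a ⟶ J.obj b} {g' h' : a ⟶ b} {e₁ : g ≅ J.map g'}
    {e₂ : h ≅ J.map h'} {η : g ⟶ h} {f : J.obj b ⟶ J.obj c} {f' : b ⟶ c} (e : f ≅ J.map f') :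
    ConjInImage J e₁ e₂ η →
      ConjInImage J (compImageIso J e₁ e) (compImageIso J e₂ e) (η ▷ f) := by
  rintro ⟨η', hη⟩
  refine ⟨η' ▷ f', ?_⟩
  simp only [compImageIso, Iso.trans_hom, whiskerRightIso_hom, whiskerLeftIso_hom, Iso.symm_hom,
    J.map₂_whisker_right, Category.assoc, Iso.inv_hom_id_assoc]
  rw [← comp_whiskerRight_assoc, hη, comp_whiskerRight_assoc, whisker_exchange_assoc]

theorem congr {f g : J.obj a ⟶ J.obj b} {f' g' : a ⟶ b} {e : f ≅ J.map f'}
    {d : g ≅ J.map g'} {η θ : f ⟶ g} (h : η = θ) : ConjInImage J e d θ → ConjInImage J e d η :=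
  fun hθ => h ▸ hθ

/-- The hypotheses say that two choices of isomorphism differ by a 2-cell in the image of `J`. The
factors are changed one at a time, passing through `compImageIso J e₂ d₁`. -/
theorem compImageIso_id {f : J.obj a ⟶ J.obj b} {g : J.obj b ⟶ J.obj c}
    {f₁ f₂ : a ⟶ b} {g₁ g₂ : b ⟶ c} {e₁ : f ≅ J.map f₁} {e₂ : f ≅ J.map f₂} {d₁ : g ≅ J.map g₁}
    {d₂ : g ≅ J.map g₂} (he : ConjInImage J e₁ e₂ (𝟙 f)) (hd : ConjInImage J d₁ d₂ (𝟙 g)) :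
    ConjInImage J (compImageIso J e₁ d₁) (compImageIso J e₂ d₂) (𝟙 (f ≫ g)) :=
  .congr (by simp) ((he.whiskerRight d₁).comp (hd.whiskerLeft e₂))

theorem change_right {f g : J.obj a ⟶ J.obj b} {f' g₁ g₂ : a ⟶ b} {e : f ≅ J.map f'}
    {d₁ : g ≅ J.map g₁} {d₂ : g ≅ J.map g₂} {η : f ⟶ g} (h : ConjInImage J e d₁ η)
    (hd : ConjInImage J d₁ d₂ (𝟙 g)) : ConjInImage J e d₂ η :=
  .congr (Category.comp_id η).symm (h.comp hd)

theorem change_left {f g : J.obj a ⟶ J.obj b} {f₁ f₂ g' : a ⟶ b} {e₁ : f ≅ J.map f₁}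
    {e₂ : f ≅ J.map f₂} {d : g ≅ J.map g'} {η : f ⟶ g} (h : ConjInImage J e₂ d η)
    (he : ConjInImage J e₁ e₂ (𝟙 f)) : ConjInImage J e₁ d η :=
  .congr (Category.id_comp η).symm (he.comp h)

/-- Inverting requires an invertible preimage, not merely an invertible `η`. -/
theorem inv_of_iso {f g : J.obj a ⟶ J.obj b} {f' g' : a ⟶ b} {e : f ≅ J.map f'}
    {d : g ≅ J.map g'} {η : f ≅ g} (η' : f' ≅ g')
    (h : η.hom ≫ d.hom = e.hom ≫ J.map₂ η'.hom) : ConjInImage J d e η.inv :=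
  ⟨η'.inv, by
    rw [Iso.inv_comp_eq, reassoc_of% h, ← J.map₂_comp, Iso.hom_inv_id, J.map₂_id,
      Category.comp_id]⟩

theorem inv_of_eq {f g : J.obj a ⟶ J.obj b} {g' : a ⟶ b} {e : f ≅ J.map g'} {d : g ≅ J.map g'}
    {η : f ≅ g} (h : η.hom ≫ d.hom = e.hom) : ConjInImage J d e η.inv :=
  inv_of_iso (Iso.refl g') (by simp [h])

section

variable {f : J.obj a ⟶ J.obj b} {g : J.obj b ⟶ J.obj c} {h : J.obj c ⟶ J.obj d}
  {f' : a ⟶ b} {g' : b ⟶ c} {h' : c ⟶ d}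

/-- Naturality of the associator and interchange reduce this to the associativity axiom of `J`. -/
theorem associator_comp_compImageIso (e₁ : f ≅ J.map f')
    (e₂ : g ≅ J.map g') (e₃ : h ≅ J.map h') :
    (α_ f g h).hom ≫ (compImageIso J e₁ (compImageIso J e₂ e₃)).hom =
      (compImageIso J (compImageIso J e₁ e₂) e₃).hom ≫ J.map₂ (α_ f' g' h').hom := by
  simp [compImageIso, J.map₂_associator, whisker_exchange_assoc]

theorem associator (e₁ : f ≅ J.map f') (e₂ : g ≅ J.map g') (e₃ : h ≅ J.map h') :
    ConjInImage J (compImageIso J (compImageIso J e₁ e₂) e₃)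
      (compImageIso J e₁ (compImageIso J e₂ e₃)) (α_ f g h).hom :=
  ⟨_, associator_comp_compImageIso e₁ e₂ e₃⟩

theorem associator_inv (e₁ : f ≅ J.map f') (e₂ : g ≅ J.map g') (e₃ : h ≅ J.map h') :
    ConjInImage J (compImageIso J e₁ (compImageIso J e₂ e₃))
      (compImageIso J (compImageIso J e₁ e₂) e₃) (α_ f g h).inv :=
  inv_of_iso (α_ f' g' h') (associator_comp_compImageIso e₁ e₂ e₃)

/-- The formal unit is compared with `J.map (𝟙 a)` through the unit constraint, so this is the unit
axiom of `J` together with naturality of the unitor. -/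
theorem leftUnitor_comp_hom (e : f ≅ J.map f') :
    (λ_ f).hom ≫ e.hom = (compImageIso J (J.mapId a).symm e).hom ≫ J.map₂ (λ_ f').hom := by
  simp [compImageIso, J.map₂_left_unitor, whisker_exchange_assoc]

theorem leftUnitor (e : f ≅ J.map f') :
    ConjInImage J (compImageIso J (J.mapId a).symm e) e (λ_ f).hom :=
  ⟨_, leftUnitor_comp_hom e⟩

theorem leftUnitor_inv (e : f ≅ J.map f') :
    ConjInImage J e (compImageIso J (J.mapId a).symm e) (λ_ f).inv :=
  inv_of_iso (λ_ f') (leftUnitor_comp_hom e)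

theorem rightUnitor_comp_hom (e : f ≅ J.map f') :
    (ρ_ f).hom ≫ e.hom = (compImageIso J e (J.mapId b).symm).hom ≫ J.map₂ (ρ_ f').hom := by
  simp [compImageIso, J.map₂_right_unitor]

theorem rightUnitor (e : f ≅ J.map f') :
    ConjInImage J (compImageIso J e (J.mapId b).symm) e (ρ_ f).hom :=
  ⟨_, rightUnitor_comp_hom e⟩

theorem rightUnitor_inv (e : f ≅ J.map f') :
    ConjInImage J e (compImageIso J e (J.mapId b).symm) (ρ_ f).inv :=
  inv_of_iso (ρ_ f') (rightUnitor_comp_hom e)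

end

theorem eq_of_isThin [∀ a b : B, Quiver.IsThin (a ⟶ b)] {f g : J.obj a ⟶ J.obj b} {f' g' : a ⟶ b}
    {e : f ≅ J.map f'} {d : g ≅ J.map g'} {η θ : f ⟶ g} :
    ConjInImage J e d η → ConjInImage J e d θ → η = θ := by
  rintro ⟨η', hη⟩ ⟨θ', hθ⟩
  rw [← cancel_mono d.hom, hη, hθ, Subsingleton.elim η' θ']

end ConjInImage

end Image

/-! ### Expansion of words and local thinness of the free target -/

section Thin

variable {G : Type u₁} [Quiver.{v₁} G] {M : Type u₂} [Quiver.{v₂} M] (H : G ⥤q M)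

/-- The strict functor from the free bicategory on `M` to the target of the free pseudofunctor
on `H : G ⥤q M`. -/
abbrev inclusion : FreeBicategory M ⥤ᵖ Target H := FreeBicategory.lift (ofTarget H)

/-- The image under `H` of a 0-cell of the free bicategory on `G`. -/
abbrev freeObj (a : FreeBicategory G) : FreeBicategory M := H.obj a

/-- The image under `H` of a 1-cell of the free bicategory on `G`. -/
abbrev freeMap {a b : FreeBicategory G} (w : a ⟶ b) : freeObj H a ⟶ freeObj H b :=
  FreeBicategory.liftHom (H ⋙q FreeBicategory.of) w

/-- The structure isomorphism `F(w) ≅ H(w)` expanding all units and composites in `w`. -/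
def mapWordIso : {a b : FreeBicategory G} → (w : a ⟶ b) →
    ((free H).map w ≅ (inclusion H).map (freeMap H w))
  | _, _, .of X => Iso.refl ((free H).map (FreeBicategory.of.map X))
  | _, _, .id a => (free H).mapId a ≪≫ ((inclusion H).mapId (freeObj H a)).symm
  | _, _, .comp f g =>
      (free H).mapComp f g ≪≫ compImageIso (inclusion H) (mapWordIso f) (mapWordIso g)

/-- The word in the edges of `M` obtained from a 1-cell of `Target H` by expanding all terms
`F(w)`. -/
def expand : {A B : Target H} → (A ⟶ B) →
    (Quiver.Hom (V := FreeBicategory M) A B)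
  | _, _, .edge Y => .of Y
  | _, _, .mapId a => 𝟙 (freeObj H a)
  | _, _, .mapComp f g => freeMap H f ≫ freeMap H g
  | _, _, .id A => .id A
  | _, _, .comp f g => (expand f).comp (expand g)

/-- The structure isomorphism from a 1-cell of `Target H` to its expansion. -/
def expandIso : {A B : Target H} → (w : A ⟶ B) → (w ≅ (inclusion H).map (expand H w))
  | _, _, .edge Y => Iso.refl ((inclusion H).map (FreeBicategory.of.map Y))
  | _, _, .mapId a => mapWordIso H (𝟙 a)
  | _, _, .mapComp f g => mapWordIso H (f ≫ g)
  | _, _, .id A => ((inclusion H).mapId A).symm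
  | _, _, .comp f g => compImageIso (inclusion H) (expandIso f) (expandIso g)

variable {H}

theorem mapId_comp_hom (a : FreeBicategory G) :
    ((free H).mapId a).hom ≫ ((inclusion H).mapId (freeObj H a)).symm.hom =
      (mapWordIso H (𝟙 a)).hom := rfl

theorem mapComp_comp_hom {a b c : FreeBicategory G} (f : a ⟶ b) (g : b ⟶ c) :
    ((free H).mapComp f g).hom ≫
        (compImageIso (inclusion H) (mapWordIso H f) (mapWordIso H g)).hom =
      (mapWordIso H (f ≫ g)).hom := rfl

theorem conjInImage_mapId (a : FreeBicategory G) :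
    ConjInImage (inclusion H) (mapWordIso H (𝟙 a)) ((inclusion H).mapId (freeObj H a)).symm
      ((free H).mapId a).hom :=
  .of_eq (mapId_comp_hom a)

theorem conjInImage_mapId_inv (a : FreeBicategory G) :
    ConjInImage (inclusion H) ((inclusion H).mapId (freeObj H a)).symm (mapWordIso H (𝟙 a))
      ((free H).mapId a).inv :=
  .inv_of_eq (mapId_comp_hom a)

theorem conjInImage_mapComp {a b c : FreeBicategory G} (f : a ⟶ b) (g : b ⟶ c) :
    ConjInImage (inclusion H) (mapWordIso H (f ≫ g))
      (compImageIso (inclusion H) (mapWordIso H f) (mapWordIso H g)) ((free H).mapComp f g).hom :=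
  .of_eq (mapComp_comp_hom f g)

theorem conjInImage_mapComp_inv {a b c : FreeBicategory G} (f : a ⟶ b) (g : b ⟶ c) :
    ConjInImage (inclusion H) (compImageIso (inclusion H) (mapWordIso H f) (mapWordIso H g))
      (mapWordIso H (f ≫ g)) ((free H).mapComp f g).inv :=
  .inv_of_eq (mapComp_comp_hom f g)

section

variable {a b c d : FreeBicategory G}

/-- Naturality of the composition constraint writes the image of `f ◁ η` as a whiskering of the
image of `η` between two constraints. -/
theorem conjInImage_map₂_whiskerLeft (f : a ⟶ b) {g h : b ⟶ c} {η : g ⟶ h}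
    (hη : ConjInImage (inclusion H) (mapWordIso H g) (mapWordIso H h) ((free H).map₂ η)) :
    ConjInImage (inclusion H) (mapWordIso H (f ≫ g)) (mapWordIso H (f ≫ h))
      ((free H).map₂ (f ◁ η)) := by
  have h1 := conjInImage_mapComp (H := H) f g
  have h2 := hη.whiskerLeft (mapWordIso H f)
  have h3 := conjInImage_mapComp_inv (H := H) f h
  exact .congr ((free H).map₂_whisker_left f η) (h1.comp (h2.comp h3))

theorem conjInImage_map₂_whiskerRight {f g : a ⟶ b} {η : f ⟶ g} (h : b ⟶ c)
    (hη : ConjInImage (inclusion H) (mapWordIso H f) (mapWordIso H g) ((free H).map₂ η)) :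
    ConjInImage (inclusion H) (mapWordIso H (f ≫ h)) (mapWordIso H (g ≫ h))
      ((free H).map₂ (η ▷ h)) := by
  have h1 := conjInImage_mapComp (H := H) f h
  have h2 := hη.whiskerRight (mapWordIso H h)
  have h3 := conjInImage_mapComp_inv (H := H) g h
  exact .congr ((free H).map₂_whisker_right η h) (h1.comp (h2.comp h3))

theorem conjInImage_map₂_associator (f : a ⟶ b) (g : b ⟶ c) (h : c ⟶ d) :
    ConjInImage (inclusion H) (mapWordIso H ((f ≫ g) ≫ h)) (mapWordIso H (f ≫ g ≫ h))
      ((free H).map₂ (α_ f g h).hom) := by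
  have h1 := conjInImage_mapComp (H := H) (f ≫ g) h
  have h2 := (conjInImage_mapComp (H := H) f g).whiskerRight (mapWordIso H h)
  -- The 0-cells are named because `inclusion H` acts on them as the identity, and they must be read
  -- here as values of its object map.
  have h3 := ConjInImage.associator (J := inclusion H) (a := freeObj H a) (b := freeObj H b)
    (c := freeObj H c) (d := freeObj H d) (mapWordIso H f) (mapWordIso H g) (mapWordIso H h)
  have h4 := (conjInImage_mapComp_inv (H := H) g h).whiskerLeft (mapWordIso H f)
  have h5 := conjInImage_mapComp_inv (H := H) f (g ≫ h)
  exact .congr ((free H).map₂_associator f g h) (h1.comp (h2.comp (h3.comp (h4.comp h5))))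

theorem conjInImage_map₂_associator_inv (f : a ⟶ b) (g : b ⟶ c) (h : c ⟶ d) :
    ConjInImage (inclusion H) (mapWordIso H (f ≫ g ≫ h)) (mapWordIso H ((f ≫ g) ≫ h))
      ((free H).map₂ (α_ f g h).inv) := by
  have h1 := conjInImage_mapComp (H := H) f (g ≫ h)
  have h2 := (conjInImage_mapComp (H := H) g h).whiskerLeft (mapWordIso H f)
  have h3 := ConjInImage.associator_inv (J := inclusion H) (a := freeObj H a) (b := freeObj H b)
    (c := freeObj H c) (d := freeObj H d) (mapWordIso H f) (mapWordIso H g) (mapWordIso H h)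
  have h4 := (conjInImage_mapComp_inv (H := H) f g).whiskerRight (mapWordIso H h)
  have h5 := conjInImage_mapComp_inv (H := H) (f ≫ g) h
  exact .congr (map₂_associator_inv f g h) (h1.comp (h2.comp (h3.comp (h4.comp h5))))

theorem conjInImage_map₂_rightUnitor (f : a ⟶ b) :
    ConjInImage (inclusion H) (mapWordIso H (f ≫ 𝟙 b)) (mapWordIso H f)
      ((free H).map₂ (ρ_ f).hom) := by
  have h1 := conjInImage_mapComp (H := H) f (𝟙 b)
  have h2 := (conjInImage_mapId (H := H) b).whiskerLeft (mapWordIso H f)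
  have h3 := ConjInImage.rightUnitor (J := inclusion H) (a := freeObj H a) (b := freeObj H b)
    (mapWordIso H f)
  exact .congr ((free H).map₂_right_unitor f) (h1.comp (h2.comp h3))

theorem conjInImage_map₂_rightUnitor_inv (f : a ⟶ b) :
    ConjInImage (inclusion H) (mapWordIso H f) (mapWordIso H (f ≫ 𝟙 b))
      ((free H).map₂ (ρ_ f).inv) := by
  have h1 := ConjInImage.rightUnitor_inv (J := inclusion H) (a := freeObj H a) (b := freeObj H b)
    (mapWordIso H f)
  have h2 := (conjInImage_mapId_inv (H := H) b).whiskerLeft (mapWordIso H f)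
  have h3 := conjInImage_mapComp_inv (H := H) f (𝟙 b)
  exact .congr (map₂_rightUnitor_inv f) (h1.comp (h2.comp h3))

theorem conjInImage_map₂_leftUnitor (f : a ⟶ b) :
    ConjInImage (inclusion H) (mapWordIso H (𝟙 a ≫ f)) (mapWordIso H f)
      ((free H).map₂ (λ_ f).hom) := by
  have h1 := conjInImage_mapComp (H := H) (𝟙 a) f
  have h2 := (conjInImage_mapId (H := H) a).whiskerRight (mapWordIso H f)
  have h3 := ConjInImage.leftUnitor (J := inclusion H) (a := freeObj H a) (b := freeObj H b)
    (mapWordIso H f)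
  exact .congr ((free H).map₂_left_unitor f) (h1.comp (h2.comp h3))

theorem conjInImage_map₂_leftUnitor_inv (f : a ⟶ b) :
    ConjInImage (inclusion H) (mapWordIso H f) (mapWordIso H (𝟙 a ≫ f))
      ((free H).map₂ (λ_ f).inv) := by
  have h1 := ConjInImage.leftUnitor_inv (J := inclusion H) (a := freeObj H a) (b := freeObj H b)
    (mapWordIso H f)
  have h2 := (conjInImage_mapId_inv (H := H) a).whiskerRight (mapWordIso H f)
  have h3 := conjInImage_mapComp_inv (H := H) (𝟙 a) f
  exact .congr (map₂_leftUnitor_inv f) (h1.comp (h2.comp h3))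

end

/-- Induction over representatives suffices: the claim is a proposition about the class, so the
relations between generators need no check. -/
theorem conjInImage_map₂_mk {a b : FreeBicategory G} {f g : a ⟶ b}
    (η : FreeBicategory.Hom₂ f g) :
    ConjInImage (inclusion H) (mapWordIso H f) (mapWordIso H g) ((free H).map₂ η.mk) := by
  induction η with
  | @id a b f =>
    exact .congr ((free H).map₂_id f)
      (.id (J := inclusion H) (a := freeObj H a) (b := freeObj H b) (mapWordIso H f))
  | vcomp η θ ihη ihθ => exact .congr ((free H).map₂_comp η.mk θ.mk) (ihη.comp ihθ)
  | whisker_left f η ih => exact conjInImage_map₂_whiskerLeft f ih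
  | whisker_right h η ih => exact conjInImage_map₂_whiskerRight h ih
  | associator f g h => exact conjInImage_map₂_associator f g h
  | associator_inv f g h => exact conjInImage_map₂_associator_inv f g h
  | right_unitor f => exact conjInImage_map₂_rightUnitor f
  | right_unitor_inv f => exact conjInImage_map₂_rightUnitor_inv f
  | left_unitor f => exact conjInImage_map₂_leftUnitor f
  | left_unitor_inv f => exact conjInImage_map₂_leftUnitor_inv f

theorem conjInImage_map₂ {a b : FreeBicategory G} {f g : a ⟶ b} (η : f ⟶ g) :
    ConjInImage (inclusion H) (mapWordIso H f) (mapWordIso H g) ((free H).map₂ η) :=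
  Quot.inductionOn η conjInImage_map₂_mk

/-- The two expansions of `F(w)` agree by definition only once the form of `w` is known. Stating the
agreement through an identity 2-cell avoids transport along an equality of 1-cells. -/
theorem conjInImage_expandIso_mapWordIso {a b : FreeBicategory G} (w : a ⟶ b) :
    ConjInImage (inclusion H) (expandIso H ((free H).map w)) (mapWordIso H w) (𝟙 _) := by
  change FreeBicategory.Hom (B := G) a b at w
  cases w <;> exact .id _

theorem conjInImage_mapWordIso_expandIso {a b : FreeBicategory G} (w : a ⟶ b) :
    ConjInImage (inclusion H) (mapWordIso H w) (expandIso H ((free H).map w)) (𝟙 _) := by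
  change FreeBicategory.Hom (B := G) a b at w
  cases w <;> exact .id _

theorem conjInImage_expandIso_mk {A B : Target H} {f g : A ⟶ B} (η : Hom₂ f g) :
    ConjInImage (inclusion H) (expandIso H f) (expandIso H g) (Quot.mk Rel η) := by
  induction η with
  | @id A B f => exact .id (J := inclusion H) (a := A) (b := B) (expandIso H f)
  | vcomp η θ ihη ihθ => exact ihη.comp ihθ
  | whisker_left f η ih => exact ih.whiskerLeft (expandIso H f)
  | whisker_right h η ih => exact ih.whiskerRight (expandIso H h)
  | @associator A B C D f g h =>
    exact .associator (J := inclusion H) (a := A) (b := B) (c := C) (d := D)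
      (expandIso H f) (expandIso H g) (expandIso H h)
  | @associator_inv A B C D f g h =>
    exact .associator_inv (J := inclusion H) (a := A) (b := B) (c := C) (d := D)
      (expandIso H f) (expandIso H g) (expandIso H h)
  | @right_unitor A B f =>
    exact .rightUnitor (J := inclusion H) (a := A) (b := B) (expandIso H f)
  | @right_unitor_inv A B f =>
    exact .rightUnitor_inv (J := inclusion H) (a := A) (b := B) (expandIso H f)
  | @left_unitor A B f =>
    exact .leftUnitor (J := inclusion H) (a := A) (b := B) (expandIso H f)
  | @left_unitor_inv A B f =>
    exact .leftUnitor_inv (J := inclusion H) (a := A) (b := B) (expandIso H f)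
  -- The induction over `FreeBicategory G` used `mapWordIso`; both ends are converted to
  -- `expandIso`.
  | map₂ η =>
    exact ((conjInImage_map₂ η).change_right (conjInImage_mapWordIso_expandIso _)).change_left
      (conjInImage_expandIso_mapWordIso _)
  | map_id a => exact conjInImage_mapId a
  | map_id_inv a => exact conjInImage_mapId_inv a
  -- At the source both isomorphisms agree by definition; at the target the two factors are
  -- converted separately.
  | map_comp f g =>
    exact (conjInImage_mapComp f g).change_right
      (.compImageIso_id (conjInImage_mapWordIso_expandIso f) (conjInImage_mapWordIso_expandIso g))
  | map_comp_inv f g =>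
    exact (conjInImage_mapComp_inv f g).change_left
      (.compImageIso_id (conjInImage_expandIso_mapWordIso f) (conjInImage_expandIso_mapWordIso g))

theorem conjInImage_expandIso {A B : Target H} {f g : A ⟶ B} (η : f ⟶ g) :
    ConjInImage (inclusion H) (expandIso H f) (expandIso H g) η :=
  Quot.inductionOn η conjInImage_expandIso_mk

/-- **Coherence for pseudofunctors**: the target of the free pseudofunctor on a map of graphs is
locally thin. -/
instance locally_thin (A B : Target H) : Quiver.IsThin (A ⟶ B) := fun _ _ =>
  ⟨fun η θ => (conjInImage_expandIso η).eq_of_isThin (conjInImage_expandIso θ)⟩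

end Thin

/-! ### Commutativity of lifted diagrams -/

section Diagrams

theorem composePath_mapPath_comp {J : Type u₁} [Quiver.{v₁} J] {K : Type u₂} [Category.{v₂} K]
    {K' : Type u₃} [Category.{v₃} K'] (L : J ⥤q K) (T : K ⥤ K') {i j : J} (p : Quiver.Path i j) :
    composePath ((L ⋙q T.toPrefunctor).mapPath p) = T.map (composePath (L.mapPath p)) := by
  induction p with
  | nil => exact (T.map_id _).symm
  | cons p e ih =>
    simp only [Prefunctor.mapPath_cons, composePath_cons, ih, T.map_comp]
    rfl

theorem DiagramCommutes.of_isExtendedFormalDiagram {C : Type u₃} [Bicategory.{w₁, v₃} C]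
    {D : Type u₄} [Bicategory.{w₂, v₄} D] {F : C ⥤ᵖ D} {G : Type u₁} [Quiver.{v₁} G] {M : Type u₂}
    [Quiver.{v₂} M] {H : G ⥤q M} {S : GraphSquare H F} {J : Type u₅} [Quiver.{v₅} J] {x y : D}
    {P : J ⥤q (x ⟶ y)} (hP : IsExtendedFormalDiagram S P) : DiagramCommutes P := by
  obtain ⟨L⟩ := hP
  intro i j p q
  rw [composePath_mapPath_comp, composePath_mapPath_comp]
  -- Both composites are images of parallel 2-cells of `Target H`, which are equal by local
  -- thinness.
  exact congrArg _ (Subsingleton.elim _ _)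

end Diagrams

end FreePseudofunctor

theorem mainTheorem11 {C : Type u₃} [Bicategory.{w₁, v₃} C] {D : Type u₄} [Bicategory.{w₂, v₄} D]
    (F : C ⥤ᵖ D) :
    (∀ {G : Type u₁} [Quiver.{v₁} G] {M : Type u₂} [Quiver.{v₂} M] (H : G ⥤q M)
      (S : FreePseudofunctor.GraphSquare H F) {J : Type u₅} [Quiver.{v₅} J] {x y : D}
      (P : J ⥤q (x ⟶ y)), FreePseudofunctor.IsExtendedFormalDiagram S P →
        FreePseudofunctor.DiagramCommutes P) ∧
    (∀ {J : Type u₅} [Quiver.{v₅} J] {x y : D} (P : J ⥤q (x ⟶ y)),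
      FreePseudofunctor.IsFormalDiagram F P → FreePseudofunctor.DiagramCommutes P) := by
  exact ⟨fun _ _ _ _ _ _ _ => FreePseudofunctor.DiagramCommutes.of_isExtendedFormalDiagram,
    fun _ => FreePseudofunctor.DiagramCommutes.of_isExtendedFormalDiagram⟩
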